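/- Let $\mathbb{R}_{\max}=\mathbb{R}\cup\{-\infty\}$, let $m,n\ge 0$, and let $A,B\in\mathbb{R}_{\max}^{m\times n}$, $c,d\in\mathbb{R}_{\max}^m$, $p,q\in\mathbb{R}_{\max}^n$, $r,s\in\mathbb{R}_{\max}$. Write $C=[A,c]$, $D=[B,d]$, $u=[p,r]$, $v=[q,s]$ and, for $\lambda\in\mathbb{R}_{\max}$, $$U=\begin{pmatrix}A&c\\ p&r\end{pmatrix},\qquad V(\lambda)=\begin{pmatrix}B&d\\ \lambda+q&\lambda+s\end{pmatrix},$$ matrices of size $(m+1)\times(n+1)$. Matrix products are taken in the max-plus sense, i.e. $(Ey)_i=\max_j(e_{ij}+y_j)$. Consider the tropical linear-fractional program, in homogeneous form, $$\text{minimize }\lambda\quad\text{subject to}\quad uy\le\lambda+vy,\ \ Cy\le Dy,\ \ y_{n+1}\ne-\infty,\ \ y\in\mathbb{R}_{\max}^{n+1},\ \lambda\in\mathbb{R}_{\max}.$$ It is called unbounded if for every $M\in\mathbb{R}$ there is a feasible pair $(y,\lambda)$ with $\lambda<M$. Assume that every row of $V(0)$ and every column of $U$ has an entry different from $-\infty$.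 Let $\mathcal{G}_0$ be the weighted bipartite digraph whose nodes are the nodes $1,\dots,m+1$ of Max and the nodes $1,\dots,n+1$ of Min, with an arc of weight $V(0)_{kl}$ from node $k$ of Max to node $l$ of Min whenever $V(0)_{kl}\neq-\infty$, and an arc of weight $-U_{ij}$ from node $j$ of Min to node $i$ of Max whenever $U_{ij}\neq-\infty$. A positional strategy of Max is a map $\sigma:\{1,\dots,m+1\}\to\{1,\dots,n+1\}$ such that $V(0)_{i\sigma(i)}\ne-\infty$ for all $i$; $\mathcal{G}^\sigma_0$ is obtained from $\mathcal{G}_0$ by deleting, at every node $i$ of Max, all outgoing arcs except the one to $\sigma(i)$. **Theorem.** The program is unbounded if and only if there exists a positional strategy $\sigma$ of Max such that every cycle (closed walk of positive length) of $\mathcal{G}^\sigma_0$ that is accessible from node $n+1$ of Min does not contain node $m+1$ of Max and has nonnegative total weight. -/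

import Mathlib

/-- The max-plus semiring `ℝ ∪ {-∞}` as a set: `⊥` is `-∞`, the tropical sum is `max`
and the tropical product is `+` (with `-∞` absorbing). -/
abbrev Rmax : Type := WithBot ℝ

namespace TropicalGame

/-- Max-plus product of a row vector and a column vector: `max_j (u_j + x_j)`. -/
def dot {n : ℕ} (u x : Fin n → Rmax) : Rmax :=
  Finset.univ.sup fun j => u j + x j

/-- Max-plus product of a matrix and a vector. -/
def mulVec {m n : ℕ} (E : Matrix (Fin m) (Fin n) Rmax) (x : Fin n → Rmax) : Fin m → Rmax :=
  fun i => dot (E i) x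

/-- Nodes of the bipartite digraph of a mean payoff game with `m` nodes of Max (`maxNode`)
and `n` nodes of Min (`minNode`). -/
inductive Node (m n : ℕ) : Type
  | maxNode : Fin m → Node m n
  | minNode : Fin n → Node m n

/-- Every node of Max has an available move. -/
def MaxCanMove {m n : ℕ} (B : Matrix (Fin m) (Fin n) Rmax) : Prop :=
  ∀ k, ∃ l, B k l ≠ ⊥

/-- Every node of Min has an available move. -/
def MinCanMove {m n : ℕ} (A : Matrix (Fin m) (Fin n) Rmax) : Prop :=
  ∀ j, ∃ i, A i j ≠ ⊥

/-- The weight of an arc in the game with payment matrices `A`, `B`: the arc `k → l` from a node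
of Max to a node of Min has weight `B k l`, the arc `j → i` from a node of Min to a node of Max has
weight `-A i j`. Only used on pairs of nodes joined by an arc, where these entries are finite. -/
def weight {m n : ℕ} (A B : Matrix (Fin m) (Fin n) Rmax) : Node m n → Node m n → ℝ
  | .maxNode k, .minNode l => (B k l).unbotD 0
  | .minNode j, .maxNode i => -(A i j).unbotD 0
  | _, _ => 0

/-- The arcs of the game digraph: an arc is present iff the corresponding entry is finite. -/
def gameDigraph {m n : ℕ} (A B : Matrix (Fin m) (Fin n) Rmax) : Digraph (Node m n) where
  Adj
    | .maxNode k, .minNode l => B k l ≠ ⊥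
    | .minNode j, .maxNode i => A i j ≠ ⊥
    | _, _ => False

/-- `σ` is a positional strategy of Max: it selects an available move at every node of Max. -/
def IsMaxStrategy {m n : ℕ} (B : Matrix (Fin m) (Fin n) Rmax) (σ : Fin m → Fin n) : Prop :=
  ∀ i, B i (σ i) ≠ ⊥

/-- The subdigraph left when Max plays `σ`: at each node `i` of Max all arcs but `i → σ i`
are removed. -/
def strategyDigraph {m n : ℕ} (A B : Matrix (Fin m) (Fin n) Rmax) (σ : Fin m → Fin n) :
    Digraph (Node m n) where
  Adj a b := (gameDigraph A B).Adj a b ∧ ∀ i, a = .maxNode i → b = .minNode (σ i)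

/-- `c 0 → c 1 → ⋯ → c (k-1) → c 0` is a cycle (of length `k ≥ 1`) of the digraph `G`; addition in
`Fin k` is cyclic, and nodes may be repeated. -/
def IsCycle {V : Type} (G : Digraph V) {k : ℕ} [NeZero k] (c : Fin k → V) : Prop :=
  ∀ t, G.Adj (c t) (c (t + 1))

/-- The total weight of a cycle. -/
def cycleWeight {V : Type} (w : V → V → ℝ) {k : ℕ} [NeZero k] (c : Fin k → V) : ℝ :=
  ∑ t, w (c t) (c (t + 1))

/-- There is a path (possibly of length zero) from `a` to `b` in `G`. -/
def Accessible {V : Type} (G : Digraph V) (a b : V) : Prop :=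
  Relation.ReflTransGen G.Adj a b

end TropicalGame

/-- The data of the tropical linear-fractional program
`minimize (px ∨ r) - (qx ∨ s)` subject to `Ax ∨ c ≤ Bx ∨ d`, `x ∈ Rmax ^ n`. -/
structure TropicalLFP (m n : ℕ) where
  A : Matrix (Fin m) (Fin n) Rmax
  B : Matrix (Fin m) (Fin n) Rmax
  c : Fin m → Rmax
  d : Fin m → Rmax
  p : Fin n → Rmax
  q : Fin n → Rmax
  r : Rmax
  s : Rmax

namespace TropicalLFP

open TropicalGame

variable {m n : ℕ} (P : TropicalLFP m n)

/-- The row `[p, r]`. -/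
def u : Fin (n + 1) → Rmax := Fin.snoc (α := fun _ => Rmax) P.p P.r

/-- The row `[q, s]`. -/
def v : Fin (n + 1) → Rmax := Fin.snoc (α := fun _ => Rmax) P.q P.s

/-- The matrix `[A, c]`. -/
def C : Matrix (Fin m) (Fin (n + 1)) Rmax :=
  fun i => Fin.snoc (α := fun _ => Rmax) (P.A i) (P.c i)

/-- The matrix `[B, d]`. -/
def D : Matrix (Fin m) (Fin (n + 1)) Rmax :=
  fun i => Fin.snoc (α := fun _ => Rmax) (P.B i) (P.d i)

/-- The matrix with rows `[A, c]` and last row `[p, r]`. -/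
def U : Matrix (Fin (m + 1)) (Fin (n + 1)) Rmax :=
  fun i j => Fin.snoc (α := fun _ => Fin (n + 1) → Rmax) (fun i => P.C i) P.u i j

/-- The matrix with rows `[B, d]` and last row `[lam + q, lam + s]`. -/
def V (lam : Rmax) : Matrix (Fin (m + 1)) (Fin (n + 1)) Rmax :=
  fun i j => Fin.snoc (α := fun _ => Fin (n + 1) → Rmax) (fun i => P.D i) (fun j => lam + P.v j) i j

/-- Feasibility of `(y, lam)` in the homogeneous form of the program: minimize `lam` subject to
`u y ≤ lam + v y`, `C y ≤ D y`, `y_{n+1} ≠ -∞`, `y ∈ Rmax ^ (n+1)`, `lam ∈ Rmax`. -/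
def Feasible (y : Fin (n + 1) → Rmax) (lam : Rmax) : Prop :=
  dot P.u y ≤ lam + dot P.v y ∧ mulVec P.C y ≤ mulVec P.D y ∧ y (Fin.last n) ≠ ⊥

/-- The minimization problem is unbounded: its objective `lam` takes values below every real
number (possibly the value `-∞`) on the feasible set. -/
def Unbounded : Prop :=
  ∀ M : ℝ, ∃ (y : Fin (n + 1) → Rmax) (lam : Rmax), P.Feasible y lam ∧ lam < (M : Rmax)

/-- The digraph `G^σ_lam` of the game with payment matrices `U`, `V(lam)` in which Max plays `σ`. -/
def G (σ : Fin (m + 1) → Fin (n + 1)) (lam : Rmax) : Digraph (Node (m + 1) (n + 1)) :=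
  strategyDigraph P.U (P.V lam) σ

end TropicalLFP

/-!
The inequalities `U y ≤ V(lam) y` are linked to the game digraph by potentials. For real `lam`, a
vector `y` is feasible together with `lam` iff each row satisfies
`U i j + y j ≤ lam_i + max_l (V(0) i l + y l)` for all `j`, where `lam_i` is `lam` on the last row
and `0` on the others (`TropicalLFP.feasible_coe_iff`).

If `(y, lam)` is feasible, let `σ` choose a maximizing `l` in every row. Then `y` is finite at all
nodes of Min accessible from the last one, and it is a potential there: adding up the inequalities
along an accessible cycle of `G^σ_0` shows that its weight plus `lam` times the number of its
visits to the last node of Max is nonnegative (`TropicalLFP.Feasible.exists_strategy`). If the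
program is unbounded this applies to `lam = -k` for all natural `k`; there are finitely many
strategies, so one `σ` serves for arbitrarily large `k`. This rules out visits to the last node of
Max and leaves a nonnegative weight.

Conversely, if all accessible cycles of `G^σ_0` avoid the last node of Max and have nonnegative
weight, then their weight stays the same after `lam` is added to the arcs leaving that node. In a
finite digraph without accessible cycles of negative weight the weights of the walks from the root
to a given node are bounded below, so their infimum is a shortest-path potential
(`TropicalGame.exists_potential`). Its negative on the accessible nodes of Min, extended by `-∞`,
is feasible together with `lam`, whatever `lam` is.
-/

namespace TropicalGame

/-! ### Shortest-path potentials in finite digraphs -/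

section Potential

variable {V : Type} {G : Digraph V} {w : V → V → ℝ}

/-- `HasWalk G w S a b x`: there is a walk from `a` to `b` in `G`, possibly of length zero, with
all nodes in `S` and of total weight `x`. -/
inductive HasWalk (G : Digraph V) (w : V → V → ℝ) (S : Set V) (a : V) : V → ℝ → Prop
  | nil (ha : a ∈ S) : HasWalk G w S a a 0
  | snoc {b c : V} {x : ℝ} (h : HasWalk G w S a b x) (hbc : G.Adj b c) (hc : c ∈ S) :
      HasWalk G w S a c (x + w b c)

lemma HasWalk.mem_start {S : Set V} {a b : V} {x : ℝ} (h : HasWalk G w S a b x) : a ∈ S := by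
  induction h with
  | nil ha => exact ha
  | snoc _ _ _ ih => exact ih

lemma Accessible.exists_hasWalk {a b : V} (w : V → V → ℝ) (h : Accessible G a b) :
    ∃ x, HasWalk G w Set.univ a b x := by
  induction h with
  | refl => exact ⟨0, .nil trivial⟩
  | tail _ hbc ih =>
    obtain ⟨x, hx⟩ := ih
    exact ⟨_, hx.snoc hbc trivial⟩

lemma HasWalk.exists_seq {S : Set V} {a b : V} {x : ℝ} (h : HasWalk G w S a b x) :
    ∃ (k : ℕ) (f : ℕ → V), f 0 = a ∧ f k = b ∧ (∀ t < k, G.Adj (f t) (f (t + 1))) ∧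
      x = ∑ t ∈ Finset.range k, w (f t) (f (t + 1)) := by
  classical
  induction h with
  | nil _ => exact ⟨0, fun _ => a, rfl, rfl, by simp, by simp⟩
  | @snoc b c x _ hbc _ ih =>
    obtain ⟨k, f, h0, hk, hadj, hx⟩ := ih
    have hf : ∀ t ≤ k, Function.update f (k + 1) c t = f t := fun t ht =>
      Function.update_of_ne (by omega) _ _
    refine ⟨k + 1, Function.update f (k + 1) c, by rw [hf 0 (Nat.zero_le _), h0], by simp, ?_, ?_⟩
    · intro t ht
      rcases Nat.lt_succ_iff_lt_or_eq.mp ht with ht | rfl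
      · rw [hf t ht.le, hf (t + 1) ht]
        exact hadj t ht
      · rw [hf t le_rfl, hk, Function.update_self]
        exact hbc
    · rw [Finset.sum_range_succ, hf k le_rfl, hk, Function.update_self, hx]
      congr 1
      refine Finset.sum_congr rfl fun t ht => ?_
      have ht := Finset.mem_range.mp ht
      rw [hf t ht.le, hf (t + 1) ht]

/-- Closed walks have nonnegative weight if cycles through their base point do. -/
lemma HasWalk.nonneg_of_closed {S : Set V} {a : V} {x : ℝ} (h : HasWalk G w S a a x)
    (hcyc : ∀ (k : ℕ) [NeZero k] (c : Fin k → V), IsCycle G c → (∃ t, c t = a) →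
      0 ≤ cycleWeight w c) : 0 ≤ x := by
  obtain ⟨k, f, h0, hk, hadj, rfl⟩ := h.exists_seq
  rcases k with _ | k
  · simp
  -- Cyclic addition agrees with addition in `ℕ` along `f`, as `f` takes the same value at both ends.
  have hstep : ∀ t : Fin (k + 1), f ((t + 1 : Fin (k + 1)) : ℕ) = f (t + 1) := by
    intro t
    rw [Fin.val_add_one]
    split_ifs with ht
    · rw [ht, h0, Fin.val_last, hk]
    · rfl
  have hc := hcyc (k + 1) (fun t => f t)
    (fun t => by simpa only [hstep] using hadj t t.isLt) ⟨0, h0⟩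
  simpa only [cycleWeight, hstep,
    Fin.sum_univ_eq_sum_range (fun t => w (f t) (f (t + 1)))] using hc

/-- Splitting a walk at its last visit to `a`, if there is one. -/
lemma HasWalk.split_last_visit {S : Set V} (a : V) {c b : V} {x : ℝ} (h : HasWalk G w S c b x) :
    HasWalk G w (S \ {a}) c b x ∨ (b = a ∧ HasWalk G w S c a x) ∨
      ∃ x₁ a' x₂, HasWalk G w S c a x₁ ∧ G.Adj a a' ∧ HasWalk G w (S \ {a}) a' b x₂ ∧
        x = x₁ + w a a' + x₂ := by
  induction h with
  | nil hc =>
    by_cases hca : c = a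
    · subst hca
      exact .inr (.inl ⟨rfl, .nil hc⟩)
    · exact .inl (.nil ⟨hc, hca⟩)
  | @snoc b d x h hbd hd ih =>
    by_cases hda : d = a
    · subst hda
      exact .inr (.inl ⟨rfl, h.snoc hbd hd⟩)
    rcases ih with ih | ⟨rfl, ih⟩ | ⟨x₁, a', x₂, h₁, ha', h₂, rfl⟩
    · exact .inl (ih.snoc hbd ⟨hd, hda⟩)
    · exact .inr (.inr ⟨x, d, 0, ih, hbd, .nil ⟨hd, hda⟩, by ring⟩)
    · exact .inr (.inr ⟨x₁, a', x₂ + w b d, h₁, ha', h₂.snoc hbd ⟨hd, hda⟩, by ring⟩)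

/-- In the absence of accessible negative cycles, a walk loses at most `K` for every node available
to it: its part up to the last visit to the starting point is closed, and after the next arc that
point is no longer available. -/
lemma HasWalk.lower_bound {r : V} {K : ℝ} (hK : 0 ≤ K) (hw : ∀ a b, -K ≤ w a b)
    (hcyc : ∀ (k : ℕ) [NeZero k] (c : Fin k → V), IsCycle G c → (∃ t, Accessible G r (c t)) →
      0 ≤ cycleWeight w c) (S : Finset V) {a b : V} {x : ℝ} (ha : Accessible G r a)
    (h : HasWalk G w (S : Set V) a b x) : -(S.card * K) ≤ x := by
  classical
  have hclosed : ∀ {T : Set V} {a : V} {x : ℝ}, Accessible G r a → HasWalk G w T a a x → 0 ≤ x :=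
    fun ha h => h.nonneg_of_closed fun k _ c hc ⟨t, ht⟩ => hcyc k c hc ⟨t, ht ▸ ha⟩
  induction S using Finset.strongInduction generalizing a b x with
  | H S ih =>
    have haS : a ∈ S := h.mem_start
    rcases h.split_last_visit a with h' | ⟨rfl, h'⟩ | ⟨x₁, a', x₂, h₁, ha', h₂, rfl⟩
    · exact absurd rfl h'.mem_start.2
    · have := hclosed ha h'
      have : 0 ≤ (S.card : ℝ) * K := by positivity
      linarith
    · have hx₁ := hclosed ha h₁
      rw [← Finset.coe_erase] at h₂
      have hx₂ := ih (S.erase a) (Finset.erase_ssubset haS) (ha.tail ha') h₂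
      have hcard : ((S.erase a).card : ℝ) = S.card - 1 := by
        rw [Finset.card_erase_of_mem haS, Nat.cast_pred (Finset.card_pos.mpr ⟨a, haS⟩)]
      rw [hcard] at hx₂
      linarith [hw a a']

/-- A finite digraph without negative cycles accessible from `r` carries a shortest-path
potential on the nodes accessible from `r`. -/
theorem exists_potential [Finite V] (G : Digraph V) (w : V → V → ℝ) (r : V)
    (hcyc : ∀ (k : ℕ) [NeZero k] (c : Fin k → V), IsCycle G c → (∃ t, Accessible G r (c t)) →
      0 ≤ cycleWeight w c) :
    ∃ h : V → ℝ, ∀ a b, Accessible G r a → G.Adj a b → h b ≤ h a + w a b := by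
  classical
  have := Fintype.ofFinite V
  obtain ⟨K, hK⟩ := (Set.finite_range fun e : V × V => |w e.1 e.2|).bddAbove
  have hK' : ∀ a b, |w a b| ≤ K := fun a b => hK ⟨(a, b), rfl⟩
  have hK0 : 0 ≤ K := (abs_nonneg _).trans (hK' r r)
  refine ⟨fun b => sInf {x | HasWalk G w Set.univ r b x}, fun a b ha hab => ?_⟩
  have hbdd : BddBelow {x | HasWalk G w Set.univ r b x} := by
    refine ⟨-((Finset.univ : Finset V).card * K), fun x hx => ?_⟩
    refine HasWalk.lower_bound hK0 (fun a b => (abs_le.mp (hK' a b)).1) hcyc Finset.univ .refl ?_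
      (b := b)
    rw [Finset.coe_univ]
    exact hx
  rw [← sub_le_iff_le_add]
  refine le_csInf (ha.exists_hasWalk w) fun x hx => ?_
  rw [sub_le_iff_le_add]
  exact csInf_le hbdd (HasWalk.snoc hx hab trivial)

end Potential

/-! ### Telescoping along cycles -/

section Cycle

variable {V : Type} {G : Digraph V} {k : ℕ} [NeZero k] {c : Fin k → V}

lemma IsCycle.accessible {r : V} (hc : IsCycle G c) {t : Fin k} (ht : Accessible G r (c t))
    (s : Fin k) : Accessible G r (c s) := by
  have hadd : ∀ j : ℕ, Accessible G r (c (t + Fin.ofNat k j)) := by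
    intro j
    induction j with
    | zero => simpa using ht
    | succ j ih =>
      have h : t + Fin.ofNat k (j + 1) = t + Fin.ofNat k j + 1 := by
        rw [add_assoc]
        congr 1
        ext
        simp [Fin.val_add]
      rw [h]
      exact ih.tail (hc _)
  have := hadd (s - t : Fin k)
  rwa [Fin.ofNat_eq_cast, Fin.cast_val_eq_self, add_sub_cancel] at this

lemma IsCycle.cycleWeight_nonneg_of_potential {w : V → V → ℝ} (h : V → ℝ)
    (hh : ∀ t, h (c t) ≤ w (c t) (c (t + 1)) + h (c (t + 1))) : 0 ≤ cycleWeight w c := by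
  have hsum := Finset.sum_le_sum fun t (_ : t ∈ Finset.univ) => hh t
  have hshift : ∑ t, h (c (t + 1)) = ∑ t, h (c t) :=
    Equiv.sum_comp (Equiv.addRight (1 : Fin k)) fun t => h (c t)
  rw [Finset.sum_add_distrib, hshift] at hsum
  exact nonneg_of_le_add_left hsum

end Cycle

/-! ### Max-plus row products and digraphs of games -/

instance {m n : ℕ} : Finite (Node m n) :=
  Finite.of_surjective (Sum.elim Node.maxNode Node.minNode : Fin m ⊕ Fin n → Node m n) fun a => by
    cases a with
    | maxNode i => exact ⟨.inl i, rfl⟩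
    | minNode j => exact ⟨.inr j, rfl⟩

lemma dot_le_iff {n : ℕ} {u x : Fin n → Rmax} {z : Rmax} :
    dot u x ≤ z ↔ ∀ j, u j + x j ≤ z := by
  simp [dot]

lemma le_dot {n : ℕ} (u x : Fin n → Rmax) (j : Fin n) : u j + x j ≤ dot u x :=
  dot_le_iff.mp le_rfl j

lemma exists_dot_eq {n : ℕ} (u x : Fin (n + 1) → Rmax) : ∃ j, dot u x = u j + x j := by
  obtain ⟨j, -, hj⟩ := Finset.exists_mem_eq_sup Finset.univ Finset.univ_nonempty
    fun j => u j + x j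
  exact ⟨j, hj⟩

/-- Every row has an available move that attains the row product: any move does if the product is
`-∞`, and otherwise the entry at a maximizing index is finite. -/
lemma exists_maxStrategy_dot_le {m n : ℕ} {B : Matrix (Fin m) (Fin (n + 1)) Rmax}
    (hB : MaxCanMove B) (x : Fin (n + 1) → Rmax) :
    ∃ σ, IsMaxStrategy B σ ∧ ∀ i, dot (B i) x ≤ B i (σ i) + x (σ i) := by
  have h : ∀ i, ∃ l, B i l ≠ ⊥ ∧ dot (B i) x ≤ B i l + x l := by
    intro i
    obtain ⟨j, hj⟩ := exists_dot_eq (B i) x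
    by_cases hbot : B i j = ⊥
    · obtain ⟨l, hl⟩ := hB i
      refine ⟨l, hl, ?_⟩
      rw [hj, hbot, WithBot.bot_add]
      exact bot_le
    · exact ⟨j, hbot, hj.le⟩
  choose σ h₁ h₂ using h
  exact ⟨σ, h₁, h₂⟩

end TropicalGame

namespace TropicalLFP

open TropicalGame

variable {m n : ℕ} (P : TropicalLFP m n)

/-! ### Feasibility for a finite value of the objective -/

/-- The amount that `lam` adds to row `i` of `V(0)`: it is `lam` on the last row and `0` on the
others. -/
noncomputable def rowShift (lam : ℝ) (i : Fin (m + 1)) : ℝ :=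
  if i = Fin.last m then lam else 0

/-- The amount that `lam` adds to the weight of the arcs leaving a node of the game digraph. -/
noncomputable def nodeShift (lam : ℝ) : Node (m + 1) (n + 1) → ℝ
  | .maxNode i => rowShift lam i
  | .minNode _ => 0

lemma nodeShift_eq_mul (lam : ℝ) (a : Node (m + 1) (n + 1)) :
    nodeShift lam a = lam * nodeShift 1 a := by
  cases a <;> simp [nodeShift, rowShift]

lemma nodeShift_one_nonneg (a : Node (m + 1) (n + 1)) : 0 ≤ nodeShift 1 a := by
  cases a with
  | maxNode i =>
    simp only [nodeShift, rowShift]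
    split_ifs <;> norm_num
  | minNode j => exact le_rfl

lemma nodeShift_of_ne (lam : ℝ) {a : Node (m + 1) (n + 1)} (ha : a ≠ .maxNode (Fin.last m)) :
    nodeShift lam a = 0 := by
  cases a with
  | maxNode i => exact if_neg fun h => ha (congrArg _ h)
  | minNode j => rfl

lemma feasible_coe_iff (y : Fin (n + 1) → Rmax) (lam : ℝ) :
    P.Feasible y lam ↔
      (∀ i, dot (P.U i) y ≤ (rowShift lam i : Rmax) + dot (P.V 0 i) y) ∧ y (Fin.last n) ≠ ⊥ := by
  have hlast : P.V 0 (Fin.last m) = P.v := by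
    funext j
    simp [V]
  have hlast' : P.U (Fin.last m) = P.u := by
    funext j
    simp [U]
  have hcast : ∀ i : Fin m, P.V 0 i.castSucc = P.D i := fun i => by
    funext j
    simp [V]
  have hcast' : ∀ i : Fin m, P.U i.castSucc = P.C i := fun i => by
    funext j
    simp [U]
  rw [Fin.forall_fin_succ']
  simp only [hlast, hlast', hcast, hcast', rowShift, Fin.castSucc_ne_last, if_true, if_false,
    WithBot.coe_zero, zero_add, Feasible, Pi.le_def, mulVec]
  tauto

variable {P} in
lemma Feasible.mono {y : Fin (n + 1) → Rmax} {lam lam' : Rmax} (h : P.Feasible y lam)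
    (hle : lam ≤ lam') : P.Feasible y lam' :=
  ⟨h.1.trans (add_le_add_left hle _), h.2⟩

/-! ### From feasible points to strategies -/

variable {P} in
/-- The potential inequality behind the telescoping: a strategy `σ` attaining the row products
`V(0) y` keeps the play inside the support of `y`. -/
lemma Feasible.move_le {y : Fin (n + 1) → Rmax} {lam : ℝ} (h : P.Feasible y lam)
    {σ : Fin (m + 1) → Fin (n + 1)} (hσ : IsMaxStrategy (P.V 0) σ)
    (hmax : ∀ i, dot (P.V 0 i) y ≤ P.V 0 i (σ i) + y (σ i)) {i : Fin (m + 1)} {j : Fin (n + 1)}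
    (hij : P.U i j ≠ ⊥) (hj : y j ≠ ⊥) :
    y (σ i) ≠ ⊥ ∧ (P.U i j).unbotD 0 + (y j).unbotD 0 ≤
      rowShift lam i + ((P.V 0 i (σ i)).unbotD 0 + (y (σ i)).unbotD 0) := by
  have hrow : P.U i j + y j ≤ (rowShift lam i : Rmax) + (P.V 0 i (σ i) + y (σ i)) :=
    ((le_dot _ _ j).trans (((P.feasible_coe_iff y lam).mp h).1 i)).trans
      (add_le_add_right (hmax i) _)
  have hv := hσ i
  revert hrow hv hij hj
  generalize P.U i j = α, y j = β, P.V 0 i (σ i) = γ, y (σ i) = δ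
  intro hα hβ hrow hγ
  lift α to ℝ using hα
  lift β to ℝ using hβ
  lift γ to ℝ using hγ
  have hδ : δ ≠ ⊥ := by
    rintro rfl
    rw [WithBot.add_bot, WithBot.add_bot, ← WithBot.coe_add] at hrow
    exact WithBot.coe_ne_bot (le_bot_iff.mp hrow)
  lift δ to ℝ using hδ
  exact ⟨WithBot.coe_ne_bot, by simpa using mod_cast hrow⟩

variable {P} in
/-- Each feasible point yields a strategy all of whose accessible cycles have nonnegative weight
in the game for the value `lam`. -/
theorem Feasible.exists_strategy {y : Fin (n + 1) → Rmax} {lam : ℝ} (h : P.Feasible y lam)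
    (hMax : MaxCanMove (P.V 0)) :
    ∃ σ, IsMaxStrategy (P.V 0) σ ∧
      ∀ (k : ℕ) [NeZero k] (c : Fin k → Node (m + 1) (n + 1)), IsCycle (P.G σ 0) c →
        (∃ t, Accessible (P.G σ 0) (.minNode (Fin.last n)) (c t)) →
          0 ≤ cycleWeight (weight P.U (P.V 0)) c + ∑ t, nodeShift lam (c t) := by
  obtain ⟨σ, hσ, hmax⟩ := exists_maxStrategy_dot_le hMax y
  refine ⟨σ, hσ, fun k _ c hc ⟨t₀, ht₀⟩ => ?_⟩
  -- `y` is finite at the accessible nodes of Min and at the moves of the accessible nodes of Max.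
  let supp : Node (m + 1) (n + 1) → Prop
    | .maxNode i => y (σ i) ≠ ⊥
    | .minNode j => y j ≠ ⊥
  have hsupp : ∀ a, Accessible (P.G σ 0) (.minNode (Fin.last n)) a → supp a := by
    intro a ha
    induction ha with
    | refl => exact h.2.2
    | @tail a b _ hab ih =>
      rcases a with i | j <;> rcases b with i' | j'
      · exact hab.1.elim
      · obtain rfl : j' = σ i := by simpa using hab.2 i rfl
        exact ih
      · exact (h.move_le hσ hmax hab.1 ih).1
      · exact hab.1.elim
  let pot : Node (m + 1) (n + 1) → ℝ
    | .maxNode i => rowShift lam i + ((P.V 0 i (σ i)).unbotD 0 + (y (σ i)).unbotD 0)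
    | .minNode j => (y j).unbotD 0
  have hpot : ∀ a b, supp a → (P.G σ 0).Adj a b →
      pot a ≤ weight P.U (P.V 0) a b + nodeShift lam a + pot b := by
    intro a b ha hab
    rcases a with i | j <;> rcases b with i' | j'
    · exact hab.1.elim
    · obtain rfl : j' = σ i := by simpa using hab.2 i rfl
      simp only [pot, weight, nodeShift]
      linarith
    · have := (h.move_le hσ hmax hab.1 ha).2
      simp only [pot, weight, nodeShift]
      linarith
    · exact hab.1.elim
  have := IsCycle.cycleWeight_nonneg_of_potential (c := c)
    (w := fun a b => weight P.U (P.V 0) a b + nodeShift lam a) pot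
    fun t => hpot _ _ (hsupp _ (hc.accessible ht₀ t)) (hc t)
  rwa [cycleWeight, Finset.sum_add_distrib] at this

/-! ### From strategies to feasible points -/

/-- If no accessible cycle is negative in the game for the value `lam`, then `lam` is attained by
a feasible point. -/
theorem exists_feasible (lam : ℝ) {σ : Fin (m + 1) → Fin (n + 1)}
    (hσ : IsMaxStrategy (P.V 0) σ)
    (hcyc : ∀ (k : ℕ) [NeZero k] (c : Fin k → Node (m + 1) (n + 1)), IsCycle (P.G σ 0) c →
      (∃ t, Accessible (P.G σ 0) (.minNode (Fin.last n)) (c t)) →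
        0 ≤ cycleWeight (weight P.U (P.V 0)) c + ∑ t, nodeShift lam (c t)) :
    ∃ y, P.Feasible y lam := by
  classical
  obtain ⟨h, hh⟩ := exists_potential (P.G σ 0)
    (fun a b => weight P.U (P.V 0) a b + nodeShift lam a) (.minNode (Fin.last n))
    fun k _ c hc hacc => by
      rw [cycleWeight, Finset.sum_add_distrib]
      exact hcyc k c hc hacc
  let acc : Node (m + 1) (n + 1) → Prop := Accessible (P.G σ 0) (.minNode (Fin.last n))
  let y : Fin (n + 1) → Rmax := fun j =>
    if acc (.minNode j) then ((-h (.minNode j) : ℝ) : Rmax) else ⊥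
  have hy : ∀ j, acc (.minNode j) → y j = ((-h (.minNode j) : ℝ) : Rmax) := fun j hj => if_pos hj
  refine ⟨y, (P.feasible_coe_iff y lam).mpr ⟨fun i => ?_, ?_⟩⟩
  · refine dot_le_iff.mpr fun j => ?_
    by_cases hij : P.U i j = ⊥
    · simp [hij]
    by_cases hj : acc (.minNode j)
    swap
    · simp [y, hj]
    have hji : (P.G σ 0).Adj (.minNode j) (.maxNode i) := ⟨hij, by simp⟩
    have hil : (P.G σ 0).Adj (.maxNode i) (.minNode (σ i)) := ⟨hσ i, by simp⟩
    have hi : acc (.maxNode i) := hj.tail hji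
    have h₁ := hh _ _ hj hji
    have h₂ := hh _ _ hi hil
    refine le_trans ?_ (add_le_add_right (le_dot (P.V 0 i) y (σ i)) _)
    rw [hy j hj, hy (σ i) (hi.tail hil)]
    have hv := hσ i
    simp only [weight, nodeShift] at h₁ h₂
    revert h₁ h₂ hij hv
    generalize P.U i j = α, P.V 0 i (σ i) = γ
    intro hα h₁ h₂ hγ
    lift α to ℝ using hα
    lift γ to ℝ using hγ
    simp only [WithBot.unbotD_coe] at h₁ h₂
    norm_cast
    linarith
  · rw [hy _ .refl]
    exact WithBot.coe_ne_bot

end TropicalLFP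

/-! ### Unboundedness -/

theorem mainTheorem2 {m n : ℕ} (P : TropicalLFP m n)
    (hMax : TropicalGame.MaxCanMove (P.V 0)) (hMin : TropicalGame.MinCanMove P.U) :
    P.Unbounded ↔
      ∃ σ : Fin (m + 1) → Fin (n + 1), TropicalGame.IsMaxStrategy (P.V 0) σ ∧
        ∀ (k : ℕ) [NeZero k] (c : Fin k → TropicalGame.Node (m + 1) (n + 1)),
          TropicalGame.IsCycle (P.G σ 0) c →
          (∃ t, TropicalGame.Accessible (P.G σ 0) (.minNode (Fin.last n)) (c t)) →
            (∀ t, c t ≠ .maxNode (Fin.last m)) ∧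
              0 ≤ TropicalGame.cycleWeight (TropicalGame.weight P.U (P.V 0)) c := by
  constructor
  · intro hunb
    have hfeas : ∀ N : ℕ, ∃ y, P.Feasible y ((-N : ℝ) : Rmax) := fun N => by
      obtain ⟨y, lam, hy, hlam⟩ := hunb (-N)
      exact ⟨y, hy.mono hlam.le⟩
    choose y hy using hfeas
    choose σ hσ hcyc using fun N => (hy N).exists_strategy hMax
    obtain ⟨τ, hτ⟩ := Finite.exists_infinite_fiber σ
    have hinf : (σ ⁻¹' {τ}).Infinite := Set.infinite_coe_iff.mp hτ
    obtain ⟨N₀, rfl⟩ := hinf.nonempty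
    refine ⟨σ N₀, hσ N₀, fun k _ c hc hacc => ?_⟩
    set W := TropicalGame.cycleWeight (TropicalGame.weight P.U (P.V 0)) c
    -- `visits` is the number of visits of the cycle to the last node of Max.
    set visits : ℝ := ∑ t, TropicalLFP.nodeShift 1 (c t)
    have hlarge : ∀ K : ℕ, ∃ N : ℕ, K < N ∧ N * visits ≤ W := by
      intro K
      obtain ⟨N, hN, hKN⟩ := hinf.exists_gt K
      have hle := hcyc N k c
      rw [show σ N = σ N₀ from hN] at hle
      have hle := hle hc hacc
      simp only [TropicalLFP.nodeShift_eq_mul (-(N : ℝ)), ← Finset.mul_sum] at hle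
      exact ⟨N, hKN, by linarith⟩
    have hvisits : 0 ≤ visits := Finset.sum_nonneg fun t _ => TropicalLFP.nodeShift_one_nonneg _
    refine ⟨fun t ht => ?_, ?_⟩
    · have hone : 1 ≤ visits := by
        have hct : TropicalLFP.nodeShift 1 (c t) = 1 := by
          simp [ht, TropicalLFP.nodeShift, TropicalLFP.rowShift]
        rw [← hct]
        exact Finset.single_le_sum (f := fun t => TropicalLFP.nodeShift 1 (c t))
          (fun t _ => TropicalLFP.nodeShift_one_nonneg _) (Finset.mem_univ t)
      obtain ⟨K, hK⟩ := exists_nat_gt W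
      obtain ⟨N, hKN, hN⟩ := hlarge K
      have hKN : (K : ℝ) < N := mod_cast hKN
      nlinarith [Nat.cast_nonneg (α := ℝ) N]
    · obtain ⟨N, -, hN⟩ := hlarge 0
      exact (mul_nonneg N.cast_nonneg hvisits).trans hN
  · rintro ⟨σ, hσ, hcyc⟩ M
    obtain ⟨y, hy⟩ := P.exists_feasible (M - 1) hσ fun k _ c hc hacc => by
      obtain ⟨havoid, hW⟩ := hcyc k c hc hacc
      rw [Finset.sum_eq_zero fun t _ => TropicalLFP.nodeShift_of_ne _ (havoid t), add_zero]
      exact hW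
    exact ⟨y, _, hy, WithBot.coe_lt_coe.mpr (sub_one_lt M)⟩
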